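/- Let $L_x,L_y,L_z\ge 1$ and consider the cubic lattice on the 3-torus with vertex set $\mathbb Z_{L_x}\times\mathbb Z_{L_y}\times\mathbb Z_{L_z}$. Write $e_d$ ($d=x,y,z$) for the unit translations; the link $(v,d)$ joins $v$ to $v+e_d$, and every link $\ell$ carries two qubits, with Pauli operators $X_i^\ell, Z_i^\ell$, $i=1,2$. For a vertex $V$ and $i=1,2$ let $A_{V,i}=\prod_{d} X_i^{(V,d)}X_i^{(V-e_d,d)}$ be the product of $X_i$ over the six link ends at $V$. For the plaquette $P$ with base vertex $v$ and normal direction $d$, spanned by the two other directions $a,b$, let $\partial P$ consist of the four links $(v,a),(v+e_b,a),(v,b),(v+e_a,b)$, let $O=(v+e_a+e_b,d)$ and $U=(v-e_d,d)$ be the links over and under $P$, and put $$B_{P,1}=X_1^{O}X_1^{U}X_2^{U}\prod_{\ell\in\partial P}Z_1^\ell,\qquad B_{P,2}=X_1^{O}X_2^{O}X_2^{U}\prod_{\ell\in\partial P}Z_2^\ell .$$ (All products are taken with multiplicity if some $L_d=1$.) The three-fermion Walker-Wang Hamiltonian is $$H=-\sum_V (A_{V,1}+A_{V,2})-\sum_P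 (B_{P,1}+B_{P,2}).$$ Then, for all $L_x,L_y,L_z\ge1$, $H$ is Hermitian and frustration-free (some ground state of $H$ is a ground state of every individual term $-A_{V,i}$, $-B_{P,i}$), and its ground state is nondegenerate (unique up to a scalar), with $A_{V,i}\psi=\psi$ and $B_{P,i}\psi=\psi$ for all $V$, $P$, $i$ on the ground state $\psi$. Moreover, let $R=\mathbb F_2[x^{\pm1},y^{\pm1},z^{\pm1}]$ and let $\sigma$ be the $12\times 8$ stabilizer matrix over $R$ whose columns record $A_{V,1},A_{V,2}$, then $B_{P,1}$ for $P$ normal to $z,y,x$, then $B_{P,2}$ for $P$ normal to $z,y,x$ (rows: $X$-parts on the first qubits of the $x$-, $y$-, $z$-links, then on the second qubits, followed by the $Z$-parts in the same order): $$\sigma=\begin{pmatrix} 1+x^{-1}&0&0&0&yz+x^{-1}&0&0&yz\\ 1+y^{-1}&0&0&xz+y^{-1}&0&0&xz&0\\ 1+z^{-1}&0&xy+z^{-1}&0&0&xy&0&0\\ 0&1+x^{-1}&0&0&x^{-1}&0&0&yz+x^{-1}\\ 0&1+y^{-1}&0&y^{-1}&0&0&xz+y^{-1}&0\\ 0&1+z^{-1}&z^{-1}&0&0&xy+z^{-1}&0&0\\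 0&0&y+1&z+1&0&0&0&0\\ 0&0&x+1&0&z+1&0&0&0\\ 0&0&0&x+1&y+1&0&0&0\\ 0&0&0&0&0&y+1&z+1&0\\ 0&0&0&0&0&x+1&0&z+1\\ 0&0&0&0&0&0&x+1&y+1 \end{pmatrix}.$$ Then the ideal $I_6(\sigma)\subseteq R$ generated by all $6\times6$ minors of $\sigma$ is $R$. -/

import Mathlib

namespace WalkerWang

noncomputable section

/-! ### Ground states of finite-dimensional Hamiltonians -/

/-- `ψ` is a ground state of `H`: a nonzero eigenvector for the least real eigenvalue.
(For a Hermitian matrix every eigenvalue is real.) -/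
def IsGroundState {n : Type*} [Fintype n] (H : Matrix n n ℂ) (ψ : n → ℂ) : Prop :=
  ψ ≠ 0 ∧ ∃ E : ℝ, H.mulVec ψ = (E : ℂ) • ψ ∧
    ∀ (E' : ℝ) (φ : n → ℂ), φ ≠ 0 → H.mulVec φ = (E' : ℂ) • φ → E ≤ E'

/-- `H = ∑ i, h i` is frustration-free with respect to the terms `h i`: some ground state of `H`
is at the same time a ground state of every single term. -/
def FrustrationFree {n ι : Type*} [Fintype n] [Fintype ι]
    (H : Matrix n n ℂ) (h : ι → Matrix n n ℂ) : Prop :=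
  H = ∑ i, h i ∧ ∃ ψ, IsGroundState H ψ ∧ ∀ i, IsGroundState (h i) ψ

/-! ### The lattice -/

/-- Vertices of the cubic lattice on the 3-torus of size `L 0 × L 1 × L 2`. -/
abbrev Site (L : Fin 3 → ℕ) : Type := (i : Fin 3) → ZMod (L i)

/-- The unit translation in direction `d`. -/
def e (L : Fin 3 → ℕ) (d : Fin 3) : Site L := Pi.single d 1

/-- Links: `(v, d)` is the link from the vertex `v` to the vertex `v + e d`. -/
abbrev Link (L : Fin 3 → ℕ) : Type := Site L × Fin 3

/-- Plaquettes: `(v, d)` is the square spanned at the vertex `v` by the two directions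
`d + 1`, `d + 2` (modulo 3); that is, the plaquette based at `v` and normal to direction `d`. -/
abbrev Plaquette (L : Fin 3 → ℕ) : Type := Site L × Fin 3

/-- Two qubits on every link. -/
abbrev Qubit (L : Fin 3 → ℕ) : Type := Link L × Fin 2

/-- Labels of the computational basis of the many-qubit Hilbert space `(ℂ²)^{⊗ qubits}`. -/
abbrev Config (L : Fin 3 → ℕ) : Type := Qubit L → Fin 2

/-- Operators on the many-qubit Hilbert space, in the computational basis. -/
abbrev Op (L : Fin 3 → ℕ) : Type := Matrix (Config L) (Config L) ℂ

/-! ### Pauli operators -/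

/-- The one-qubit operator `M` acting on the qubit `q`, tensored with the identity elsewhere. -/
def onQubit {L : Fin 3 → ℕ} (M : Matrix (Fin 2) (Fin 2) ℂ) (q : Qubit L) : Op L :=
  open Classical in
  Matrix.of fun s t => if ∀ r, r ≠ q → s r = t r then M (s q) (t q) else 0

/-- Pauli `X` on the qubit `i` of the link `l`. -/
def X {L : Fin 3 → ℕ} (i : Fin 2) (l : Link L) : Op L := onQubit !![0, 1; 1, 0] (l, i)

/-- Pauli `Z` on the qubit `i` of the link `l`. -/
def Z {L : Fin 3 → ℕ} (i : Fin 2) (l : Link L) : Op L := onQubit !![1, 0; 0, -1] (l, i)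

/-! ### The Hamiltonian -/

variable (L : Fin 3 → ℕ) [∀ i, NeZero (L i)]

/-- The vertex operator of type `i` at `v`: the product of `X_i` over the six link ends at `v`. -/
def vertexOp (v : Site L) (i : Fin 2) : Op L :=
  (X i (v, 0) * X i (v - e L 0, 0)) * (X i (v, 1) * X i (v - e L 1, 1)) *
    (X i (v, 2) * X i (v - e L 2, 2))

/-- The product of `Z_i` over the four links in the boundary of the plaquette. -/
def boundaryZ (P : Plaquette L) (i : Fin 2) : Op L :=
  (Z i (P.1, P.2 + 1) * Z i (P.1 + e L (P.2 + 2), P.2 + 1)) *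
    (Z i (P.1, P.2 + 2) * Z i (P.1 + e L (P.2 + 1), P.2 + 2))

/-- The link `O` lying over the plaquette: it leaves the corner opposite to the base point in the
positive normal direction. -/
def overLink (P : Plaquette L) : Link L := (P.1 + e L (P.2 + 1) + e L (P.2 + 2), P.2)

/-- The link `U` lying under the plaquette: it leaves the base point in the negative normal
direction. -/
def underLink (P : Plaquette L) : Link L := (P.1 - e L P.2, P.2)

/-- `B_{P,1} = X_1^O X_1^U X_2^U ∏ Z_1` (for `i = 0`) and
`B_{P,2} = X_1^O X_2^O X_2^U ∏ Z_2` (for `i = 1`). -/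
def plaquetteOp (P : Plaquette L) (i : Fin 2) : Op L :=
  if i = 0 then
    X 0 (overLink L P) * X 0 (underLink L P) * X 1 (underLink L P) * boundaryZ L P 0
  else
    X 0 (overLink L P) * X 1 (overLink L P) * X 1 (underLink L P) * boundaryZ L P 1

/-- `H = - ∑_V (A_{V,1} + A_{V,2}) - ∑_P (B_{P,1} + B_{P,2})`. -/
def hamiltonian : Op L :=
  - (∑ v : Site L, (vertexOp L v 0 + vertexOp L v 1))
    - ∑ P : Plaquette L, (plaquetteOp L P 0 + plaquetteOp L P 1)

/-- The individual terms `-A_{V,i}`, `-B_{P,i}` of the Hamiltonian. -/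
def term : (Site L × Fin 2) ⊕ (Plaquette L × Fin 2) → Op L
  | .inl a => - vertexOp L a.1 a.2
  | .inr b => - plaquetteOp L b.1 b.2

/-! ### The stabilizer map in the polynomial framework -/

/-- The Laurent polynomial ring `𝔽₂[x^±, y^±, z^±]`, the group algebra of `ℤ³`. -/
abbrev R : Type := AddMonoidAlgebra (ZMod 2) (Fin 3 → ℤ)

/-- The Laurent monomial with exponent vector `a`. -/
def monomial (a : Fin 3 → ℤ) : R := AddMonoidAlgebra.single a 1

/-- The stabilizer map. The rows are the components `X` (first six) and `Z` (last six), each for the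
first qubits of the links along `x, y, z` and then the second ones. The columns are
`A_{V,1}`, `A_{V,2}`, then `B_{P,1}` for `P` normal to `z, y, x`, then `B_{P,2}` likewise. -/
def stabilizerMap : Matrix (Fin 12) (Fin 8) R :=
  let x : R := monomial ![1, 0, 0]
  let y : R := monomial ![0, 1, 0]
  let z : R := monomial ![0, 0, 1]
  let x' : R := monomial ![-1, 0, 0]
  let y' : R := monomial ![0, -1, 0]
  let z' : R := monomial ![0, 0, -1]
  !![1 + x', 0, 0, 0, y * z + x', 0, 0, y * z;
     1 + y', 0, 0, x * z + y', 0, 0, x * z, 0;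
     1 + z', 0, x * y + z', 0, 0, x * y, 0, 0;
     0, 1 + x', 0, 0, x', 0, 0, y * z + x';
     0, 1 + y', 0, y', 0, 0, x * z + y', 0;
     0, 1 + z', z', 0, 0, x * y + z', 0, 0;
     0, 0, y + 1, z + 1, 0, 0, 0, 0;
     0, 0, x + 1, 0, z + 1, 0, 0, 0;
     0, 0, 0, x + 1, y + 1, 0, 0, 0;
     0, 0, 0, 0, 0, y + 1, z + 1, 0;
     0, 0, 0, 0, 0, x + 1, 0, z + 1;
     0, 0, 0, 0, 0, 0, x + 1, y + 1]

/-- The determinantal ideal `I_t(M)`, generated by all `t × t` minors of `M`. -/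
def determinantalIdeal {A m n : Type*} [CommRing A] (t : ℕ) (M : Matrix m n A) : Ideal A :=
  Ideal.span {a | ∃ (r : Fin t → m) (c : Fin t → n), a = (M.submatrix r c).det}

end

end WalkerWang

namespace WalkerWang

open Matrix

noncomputable section

/-! ### Sums of Hermitian involutions: ground states and stabilized vectors -/

section Energy

open scoped ComplexOrder

variable {n ι : Type*} [Fintype n] [Fintype ι]

/-! All terms are, up to sign, Hermitian involutions `S i`, and for an eigenvector `φ` of energy `E`
the squared norms of `φ - S i φ` add up to `2 (N + E)` times the squared norm of `φ`, with `N` the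
number of terms. Hence `E ≥ -N`, with equality exactly on vectors fixed by every `S i`. It remains
to show that the common fixed space is a line.

Over `ℤ/2`, a product of plaquette operators indexed by a pair of 2-chains `b` has `Z`-part the
boundary `pairBd b`, `X`-part `pairX b`, and sign `quad b`. Here `quad` is a quadratic refinement of
the linking form `pairBd b ⬝ᵥ pairX c` (`quad_add`). Therefore the signed sum of characters
`groundState` is fixed by every term; it is nonzero because `quad` vanishes on closed `b`.

For uniqueness, pass to the Fourier transform of a fixed vector. Vertex operators and closed
surfaces restrict its support to those `a` orthogonal to all stars and to `pairX b` for closed `b`;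
by `exists_pairBd_eq` such `a` are boundaries. Plaquette operators then express every coefficient
through the one at `0`, so the sum of the entries determines the vector. The homological input is
that every pair of cocycles is `pairX b` plus coboundaries for some closed `b`. This is the
nondegenerate braiding of the three-fermion theory: over- and under-links of a closed surface are
cohomologous, so only the off-diagonal terms of `pairX` survive.

For the ideal, three diagonal minors force `x = y = z = 1` in any residue field at which all minors
vanish, and there another minor equals `1`. -/

theorem star_dotProduct_sub_involution [DecidableEq n] {S : Matrix n n ℂ} (hS : S.IsHermitian)
    (h2 : S * S = 1) (φ : n → ℂ) :
    star (φ - S *ᵥ φ) ⬝ᵥ (φ - S *ᵥ φ) = 2 * (star φ ⬝ᵥ φ) - 2 * (star φ ⬝ᵥ S *ᵥ φ) := by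
  have h1 : star (S *ᵥ φ) = star φ ᵥ* S := by rw [star_mulVec, hS.eq]
  rw [star_sub, sub_dotProduct, dotProduct_sub, dotProduct_sub, h1, ← dotProduct_mulVec,
    ← dotProduct_mulVec, mulVec_mulVec, h2, one_mulVec]
  ring

/-- The total violation of the constraints `S i φ = φ` is governed by the energy of `φ`. -/
theorem sum_star_dotProduct_sub_involution [DecidableEq n] {S : ι → Matrix n n ℂ}
    (hS : ∀ i, (S i).IsHermitian) (h2 : ∀ i, S i * S i = 1) {φ : n → ℂ} {E : ℝ}
    (h : (∑ i, -S i) *ᵥ φ = (E : ℂ) • φ) :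
    ∑ i, star (φ - S i *ᵥ φ) ⬝ᵥ (φ - S i *ᵥ φ) =
      ((2 * (Fintype.card ι + E) : ℝ) : ℂ) * (star φ ⬝ᵥ φ) := by
  have h3 : ∑ i, star φ ⬝ᵥ S i *ᵥ φ = -(E * (star φ ⬝ᵥ φ)) := by
    rw [← dotProduct_sum, ← sum_mulVec, ← neg_neg (∑ i, S i), neg_mulVec,
      ← Finset.sum_neg_distrib, h, dotProduct_neg, dotProduct_smul, smul_eq_mul]
  simp only [star_dotProduct_sub_involution (hS _) (h2 _), Finset.sum_sub_distrib,
    ← Finset.mul_sum, h3, Finset.sum_const, Finset.card_univ, nsmul_eq_mul]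
  push_cast
  ring

theorem neg_card_le_of_eigenvector [DecidableEq n] {S : ι → Matrix n n ℂ}
    (hS : ∀ i, (S i).IsHermitian) (h2 : ∀ i, S i * S i = 1) {φ : n → ℂ} (h0 : φ ≠ 0) {E : ℝ}
    (h : (∑ i, -S i) *ᵥ φ = (E : ℂ) • φ) : -(Fintype.card ι : ℝ) ≤ E := by
  have h3 := sum_star_dotProduct_sub_involution hS h2 h
  have h4 : 0 ≤ ((2 * (Fintype.card ι + E) : ℝ) : ℂ) * (star φ ⬝ᵥ φ) :=
    h3 ▸ Finset.sum_nonneg fun i _ => dotProduct_star_self_nonneg _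
  have h5 : 0 < star φ ⬝ᵥ φ := dotProduct_star_self_pos_iff.mpr h0
  have h6 := le_of_mul_le_mul_right ((zero_mul (star φ ⬝ᵥ φ)).trans_le h4) h5
  have h7 : 0 ≤ 2 * (Fintype.card ι + E) := Complex.zero_le_real.mp h6
  linarith

theorem eigenvector_of_stabilized {S : ι → Matrix n n ℂ} {ψ : n → ℂ}
    (hψ : ∀ i, S i *ᵥ ψ = ψ) :
    (∑ i, -S i) *ᵥ ψ = ((-(Fintype.card ι : ℝ) : ℝ) : ℂ) • ψ := by
  simp only [sum_mulVec, neg_mulVec, hψ, Finset.sum_const, Finset.card_univ]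
  push_cast
  rw [neg_smul, smul_neg, Nat.cast_smul_eq_nsmul]

theorem isGroundState_of_stabilized [DecidableEq n] {S : ι → Matrix n n ℂ}
    (hS : ∀ i, (S i).IsHermitian) (h2 : ∀ i, S i * S i = 1) {ψ : n → ℂ} (h0 : ψ ≠ 0)
    (hψ : ∀ i, S i *ᵥ ψ = ψ) : IsGroundState (∑ i, -S i) ψ :=
  ⟨h0, _, eigenvector_of_stabilized hψ, fun _ _ hφ h => neg_card_le_of_eigenvector hS h2 hφ h⟩

theorem stabilized_of_isGroundState [DecidableEq n] {S : ι → Matrix n n ℂ}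
    (hS : ∀ i, (S i).IsHermitian) (h2 : ∀ i, S i * S i = 1) {ψ : n → ℂ} (h0 : ψ ≠ 0)
    (hψ : ∀ i, S i *ᵥ ψ = ψ) {φ : n → ℂ} (hφ : IsGroundState (∑ i, -S i) φ) (i : ι) :
    S i *ᵥ φ = φ := by
  obtain ⟨hφ0, E, hE, hmin⟩ := hφ
  -- The stabilized vector `ψ` attains the lower bound, so the least eigenvalue is exactly minus the
  -- number of terms and the total violation is zero.
  have h3 : E = -(Fintype.card ι : ℝ) :=
    le_antisymm (hmin _ _ h0 (eigenvector_of_stabilized hψ))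
      (neg_card_le_of_eigenvector hS h2 hφ0 hE)
  have h4 := sum_star_dotProduct_sub_involution hS h2 hE
  rw [h3, add_neg_cancel, mul_zero, Complex.ofReal_zero, zero_mul,
    Finset.sum_eq_zero_iff_of_nonneg fun i _ => dotProduct_star_self_nonneg _] at h4
  exact (sub_eq_zero.mp (dotProduct_star_self_eq_zero.mp (h4 i (Finset.mem_univ i)))).symm

end Energy

/-! ### Signs -/

/-- The nontrivial character of `ℤ/2`. -/
def sgn (k : ZMod 2) : ℂ := if k = 0 then 1 else -1

@[simp] theorem sgn_zero : sgn 0 = 1 := if_pos rfl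

theorem sgn_one : sgn 1 = -1 := if_neg (by decide)

theorem sgn_add (j k : ZMod 2) : sgn (j + k) = sgn j * sgn k := by
  have h : ∀ k : ZMod 2, k = 0 ∨ k = 1 := by decide
  have h11 : (1 + 1 : ZMod 2) = 0 := by decide
  rcases h j with rfl | rfl <;> rcases h k with rfl | rfl <;> simp [sgn, h11]

theorem sgn_mul_self (k : ZMod 2) : sgn k * sgn k = 1 := by
  rw [← sgn_add, CharTwo.add_self_eq_zero, sgn_zero]

theorem sgn_eq_one_or_neg_one (k : ZMod 2) : k = 0 ∨ sgn k = -1 := by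
  by_cases h : k = 0 <;> simp [sgn, h]

theorem star_sgn (k : ZMod 2) : star (sgn k) = sgn k := by
  unfold sgn; split_ifs <;> simp

theorem add_self_eq_zero_of_bits {Q : Type*} (u : Q → ZMod 2) : u + u = 0 :=
  funext fun _ => CharTwo.add_self_eq_zero _

/-! ### Pauli operators -/

section Pauli

variable {Q : Type*}

/-- Labels of the computational basis as vectors over `ℤ/2`. -/
def bits : (Q → Fin 2) ≃ (Q → ZMod 2) := Equiv.refl _

variable [Fintype Q]

/-- The Pauli operator `φ ↦ (s ↦ (-1)^⟨a, s⟩ φ (s + u))`. -/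
def pauli (u a : Q → ZMod 2) : Matrix (Q → Fin 2) (Q → Fin 2) ℂ :=
  open Classical in
  Matrix.of fun s t => if bits t = bits s + u then sgn (a ⬝ᵥ bits s) else 0

theorem pauli_mulVec [DecidableEq Q] (u a : Q → ZMod 2) (φ : (Q → Fin 2) → ℂ) (s : Q → Fin 2) :
    (pauli u a *ᵥ φ) s = sgn (a ⬝ᵥ bits s) * φ (bits.symm (bits s + u)) := by
  classical
  simp only [mulVec, dotProduct, pauli, of_apply, ite_mul, zero_mul, ← Equiv.eq_symm_apply]
  simp

theorem pauli_mul [DecidableEq Q] (u a u' a' : Q → ZMod 2) :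
    pauli u a * pauli u' a' = sgn (a' ⬝ᵥ u) • pauli (u + u') (a + a') := by
  refine ext_of_mulVec_single fun t => ?_
  rw [← mulVec_mulVec]
  ext s
  rw [smul_mulVec, Pi.smul_apply, pauli_mulVec, pauli_mulVec, pauli_mulVec, Equiv.apply_symm_apply,
    add_assoc, dotProduct_add, add_dotProduct, sgn_add, sgn_add, smul_eq_mul]
  ring

theorem pauli_zero_zero [DecidableEq Q] : (pauli 0 0 : Matrix (Q → Fin 2) (Q → Fin 2) ℂ) = 1 := by
  refine ext_of_mulVec_single fun t => ?_
  ext s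
  rw [pauli_mulVec, one_mulVec]
  simp

theorem pauli_mul_self [DecidableEq Q] {u a : Q → ZMod 2} (h : a ⬝ᵥ u = 0) :
    pauli u a * pauli u a = 1 := by
  rw [pauli_mul, h, sgn_zero, one_smul, add_self_eq_zero_of_bits, add_self_eq_zero_of_bits,
    pauli_zero_zero]

theorem pauli_isHermitian {u a : Q → ZMod 2} (h : a ⬝ᵥ u = 0) : (pauli u a).IsHermitian := by
  ext s t
  have h1 : bits s = bits t + u ↔ bits t = bits s + u := by
    constructor <;> intro h <;> rw [h, add_assoc, add_self_eq_zero_of_bits, add_zero]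
  simp only [conjTranspose_apply, pauli, of_apply, h1]
  split_ifs with h2
  · rw [star_sgn, h2, dotProduct_add, h, add_zero]
  · simp

end Pauli

/-! ### Fourier transform on `(ℤ/2)^Q` -/

section Fourier

variable {Q : Type*} [Fintype Q] [DecidableEq Q]

theorem sum_sgn_dotProduct (a : Q → ZMod 2) :
    ∑ s : Q → ZMod 2, sgn (a ⬝ᵥ s) = if a = 0 then (Fintype.card (Q → ZMod 2) : ℂ) else 0 := by
  split_ifs with h
  · simp [h]
  · obtain ⟨q, hq⟩ := Function.ne_iff.mp h
    have h1 : sgn (a q) = -1 := (sgn_eq_one_or_neg_one _).resolve_left hq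
    -- Translating by the basis vector at a coordinate where `a` is nonzero flips every sign, so the
    -- sum equals its own negative.
    have h2 := Equiv.sum_comp (Equiv.addRight (Pi.single q (1 : ZMod 2))) fun s => sgn (a ⬝ᵥ s)
    simp only [Equiv.coe_addRight, dotProduct_add, dotProduct_single, mul_one, sgn_add, h1,
      mul_neg, Finset.sum_neg_distrib] at h2
    exact self_eq_neg.mp h2.symm

/-- The (unnormalized) Fourier transform. -/
def fourier (φ : (Q → ZMod 2) → ℂ) (a : Q → ZMod 2) : ℂ := ∑ s, sgn (a ⬝ᵥ s) * φ s

theorem eq_zero_of_fourier_eq_zero {φ : (Q → ZMod 2) → ℂ} (h : ∀ a, fourier φ a = 0) : φ = 0 := by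
  ext t
  have h1 : ∑ a, sgn (a ⬝ᵥ t) * fourier φ a = Fintype.card (Q → ZMod 2) * φ t := by
    simp only [fourier, Finset.mul_sum]
    rw [Finset.sum_comm]
    have h2 : ∀ s, ∑ a : Q → ZMod 2, sgn (a ⬝ᵥ t) * (sgn (a ⬝ᵥ s) * φ s) =
        if s = t then Fintype.card (Q → ZMod 2) * φ t else 0 := by
      intro s
      simp only [← mul_assoc, ← sgn_add, ← dotProduct_add, ← Finset.sum_mul]
      simp only [dotProduct_comm _ (t + s), sum_sgn_dotProduct]
      have h3 : t + s = 0 ↔ s = t := by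
        rw [add_eq_zero_iff_eq_neg, neg_eq_of_add_eq_zero_left (add_self_eq_zero_of_bits s), eq_comm]
      simp only [h3, ite_mul, zero_mul]
      split_ifs with h4
      · rw [h4]
      · rfl
    simp [h2]
  simp only [h, mul_zero, Finset.sum_const_zero] at h1
  simpa using h1.symm

/-- The Fourier transform exchanges the two halves of a Pauli operator: `a₀` becomes a translation
and `u` a sign. -/
theorem fourier_of_stabilized {φ : (Q → ZMod 2) → ℂ} {u a₀ : Q → ZMod 2} (h0 : a₀ ⬝ᵥ u = 0)
    (h : ∀ s, sgn (a₀ ⬝ᵥ s) * φ (s + u) = φ s) (a : Q → ZMod 2) :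
    fourier φ a = sgn (a ⬝ᵥ u) * fourier φ (a + a₀) := by
  rw [fourier, fourier, Finset.mul_sum, ← Equiv.sum_comp (Equiv.addRight u)]
  refine Finset.sum_congr rfl fun s _ => ?_
  rw [Equiv.coe_addRight, ← h (s + u), add_assoc, add_self_eq_zero_of_bits, add_zero,
    dotProduct_add, dotProduct_add, add_dotProduct, h0, add_zero, sgn_add, sgn_add]
  ring

end Fourier

/-! ### The determinantal ideal -/

theorem monomial_mul (a b : Fin 3 → ℤ) : monomial a * monomial b = monomial (a + b) := by
  simp [monomial, AddMonoidAlgebra.single_mul_single]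

theorem monomial_zero : monomial 0 = 1 := rfl

/-- A monomial and its inverse, in characteristic two, degenerate simultaneously. -/
theorem eq_one_of_minor_eq_zero {K : Type*} [Field K] [CharP K 2] {a b : K} (h : a * b = 1)
    (hm : (1 + b) ^ 2 * (a + 1) ^ 4 = 0) : a = 1 ∧ b = 1 := by
  rcases mul_eq_zero.mp hm with h1 | h1
  · have h2 : b = 1 := by
      rw [eq_comm, ← CharTwo.add_eq_zero]; exact pow_eq_zero_iff (two_ne_zero) |>.mp h1
    subst h2
    exact ⟨by simpa using h, rfl⟩
  · have h2 : a = 1 := by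
      rw [← CharTwo.add_eq_zero]; exact pow_eq_zero_iff (four_ne_zero) |>.mp h1
    subst h2
    exact ⟨rfl, by simpa using h⟩

theorem det_diagonal_six {A : Type*} [CommRing A] (a b : A) :
    (Matrix.diagonal ![a, a, b, b, b, b]).det = a ^ 2 * b ^ 4 := by
  rw [Matrix.det_diagonal, Fin.prod_univ_six]
  simp
  ring

/-- The columns are the two vertex operators and the plaquettes not normal to `x`; the rows are the
`X`-parts on the `x`-links and the `Z`-parts on the others. The next two minors are the analogues
for `y` and `z`. -/
theorem stabilizerMap_submatrix_x :
    stabilizerMap.submatrix ![0, 3, 7, 8, 10, 11] ![0, 1, 2, 3, 5, 6] =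
      Matrix.diagonal ((fun a b : R => ![a, a, b, b, b, b]) (1 + monomial ![-1, 0, 0])
        (monomial ![1, 0, 0] + 1)) := by
  ext i j : 2; fin_cases i <;> fin_cases j <;> rfl

theorem stabilizerMap_submatrix_y :
    stabilizerMap.submatrix ![1, 4, 6, 8, 9, 11] ![0, 1, 2, 4, 5, 7] =
      Matrix.diagonal ((fun a b : R => ![a, a, b, b, b, b]) (1 + monomial ![0, -1, 0])
        (monomial ![0, 1, 0] + 1)) := by
  ext i j : 2; fin_cases i <;> fin_cases j <;> rfl

theorem stabilizerMap_submatrix_z :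
    stabilizerMap.submatrix ![2, 5, 6, 7, 9, 10] ![0, 1, 3, 4, 6, 7] =
      Matrix.diagonal ((fun a b : R => ![a, a, b, b, b, b]) (1 + monomial ![0, 0, -1])
        (monomial ![0, 0, 1] + 1)) := by
  ext i j : 2; fin_cases i <;> fin_cases j <;> rfl

theorem stabilizerMap_submatrix_plaquette :
    stabilizerMap.submatrix ![0, 1, 2, 3, 4, 5] ![7, 6, 5, 4, 3, 2] =
      let x : R := monomial ![1, 0, 0]
      let y : R := monomial ![0, 1, 0]
      let z : R := monomial ![0, 0, 1]
      let x' : R := monomial ![-1, 0, 0]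
      let y' : R := monomial ![0, -1, 0]
      let z' : R := monomial ![0, 0, -1]
      !![y * z, 0, 0, y * z + x', 0, 0;
         0, x * z, 0, 0, x * z + y', 0;
         0, 0, x * y, 0, 0, x * y + z';
         y * z + x', 0, 0, x', 0, 0;
         0, x * z + y', 0, 0, y', 0;
         0, 0, x * y + z', 0, 0, z'] := by
  ext i j : 2; fin_cases i <;> fin_cases j <;> rfl

theorem determinantalIdeal_stabilizerMap : determinantalIdeal 6 stabilizerMap = ⊤ := by
  by_contra hne
  obtain ⟨P, hP, hle⟩ := Ideal.exists_le_maximal _ hne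
  let π := Ideal.Quotient.mk P
  let _ : Field (R ⧸ P) := Ideal.Quotient.field P
  have h2 : (2 : R ⧸ P) = 0 := by
    have h := congrArg ((algebraMap (ZMod 2) (R ⧸ P))) (CharTwo.two_eq_zero (R := ZMod 2))
    rwa [map_ofNat, map_zero] at h
  have : CharP (R ⧸ P) 2 := CharTwo.of_one_ne_zero_of_two_eq_zero one_ne_zero h2
  have key (r : Fin 6 → Fin 12) (c : Fin 6 → Fin 8) :
      π ((stabilizerMap.submatrix r c).det) = 0 :=
    Ideal.Quotient.eq_zero_iff_mem.mpr (hle (Ideal.subset_span ⟨r, c, rfl⟩))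
  have hinv (a b : Fin 3 → ℤ) (h : a + b = 0) : π (monomial a) * π (monomial b) = 1 := by
    rw [← map_mul, monomial_mul, h, monomial_zero, map_one]
  have hx := key ![0, 3, 7, 8, 10, 11] ![0, 1, 2, 3, 5, 6]
  have hy := key ![1, 4, 6, 8, 9, 11] ![0, 1, 2, 4, 5, 7]
  have hz := key ![2, 5, 6, 7, 9, 10] ![0, 1, 3, 4, 6, 7]
  rw [stabilizerMap_submatrix_x, det_diagonal_six] at hx
  rw [stabilizerMap_submatrix_y, det_diagonal_six] at hy
  rw [stabilizerMap_submatrix_z, det_diagonal_six] at hz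
  simp only [map_mul, map_pow, map_add, map_one] at hx hy hz
  obtain ⟨hx, hx'⟩ := eq_one_of_minor_eq_zero (hinv _ _ (by decide)) hx
  obtain ⟨hy, hy'⟩ := eq_one_of_minor_eq_zero (hinv _ _ (by decide)) hy
  obtain ⟨hz, hz'⟩ := eq_one_of_minor_eq_zero (hinv _ _ (by decide)) hz
  have h1 := key ![0, 1, 2, 3, 4, 5] ![7, 6, 5, 4, 3, 2]
  rw [RingHom.map_det] at h1
  -- At `x = y = z = 1` the binomials such as `yz + x⁻¹` vanish in characteristic two, while the
  -- diagonal monomials become `1`.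
  have h3 : π.mapMatrix (stabilizerMap.submatrix ![0, 1, 2, 3, 4, 5] ![7, 6, 5, 4, 3, 2]) = 1 := by
    rw [stabilizerMap_submatrix_plaquette]
    ext i j
    rw [RingHom.mapMatrix_apply, map_apply]
    fin_cases i <;> fin_cases j <;>
      simp [hx, hx', hy, hy', hz, hz', CharTwo.add_self_eq_zero]
  rw [h3, det_one] at h1
  exact one_ne_zero h1

/-! ### The operators of the model are Pauli operators -/

section Operators

variable {L : Fin 3 → ℕ} [∀ i, NeZero (L i)]

theorem X_eq_pauli (i : Fin 2) (l : Link L) : X i l = pauli (Pi.single (l, i) 1) 0 := by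
  ext s t
  have h1 : bits t = bits s + Pi.single (l, i) 1 ↔
      (∀ r, r ≠ (l, i) → s r = t r) ∧ t (l, i) = s (l, i) + 1 := by
    constructor
    · intro h
      refine ⟨fun r hr => ?_, ?_⟩
      · have := congrFun h r
        rw [Pi.add_apply, Pi.single_eq_of_ne hr, add_zero] at this
        exact this.symm
      · have := congrFun h (l, i)
        rwa [Pi.add_apply, Pi.single_eq_same] at this
    · rintro ⟨h, h'⟩
      ext1 r
      rw [Pi.add_apply]
      by_cases hr : r = (l, i)
      · subst hr
        rw [Pi.single_eq_same]
        exact h'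
      · rw [Pi.single_eq_of_ne hr, add_zero]
        exact (h r hr).symm
  have h2 : ∀ a b : Fin 2, (!![0, 1; 1, 0] : Matrix (Fin 2) (Fin 2) ℂ) a b =
      if b = a + 1 then 1 else 0 := by
    intro a b
    fin_cases a <;> fin_cases b <;> simp
  simp only [X, onQubit, pauli, of_apply, h1, h2, zero_dotProduct, sgn_zero, ite_and]

theorem Z_eq_pauli (i : Fin 2) (l : Link L) : Z i l = pauli 0 (Pi.single (l, i) 1) := by
  ext s t
  have h1 : bits t = bits s + 0 ↔ (∀ r, r ≠ (l, i) → s r = t r) ∧ t (l, i) = s (l, i) := by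
    rw [add_zero, bits.injective.eq_iff, funext_iff]
    constructor
    · exact fun h => ⟨fun r _ => (h r).symm, h _⟩
    · rintro ⟨h, h'⟩ r
      by_cases hr : r = (l, i)
      · rw [hr, h']
      · exact (h r hr).symm
  have h2 : ∀ a b : Fin 2, (!![1, 0; 0, -1] : Matrix (Fin 2) (Fin 2) ℂ) a b =
      if b = a then sgn (a : ZMod 2) else 0 := by
    intro a b
    fin_cases a <;> fin_cases b
    · exact sgn_zero.symm.trans (if_pos rfl).symm
    · simp
    · simp
    · exact sgn_one.symm.trans (if_pos rfl).symm
  simp only [Z, onQubit, pauli, of_apply, h1, h2, single_dotProduct, one_mul, ite_and]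
  rfl

/-- The `X`-part of a vertex operator. -/
def starVec (v : Site L) (i : Fin 2) : Qubit L → ZMod 2 :=
  (Pi.single ((v, 0), i) 1 + Pi.single ((v - e L 0, 0), i) 1) +
    (Pi.single ((v, 1), i) 1 + Pi.single ((v - e L 1, 1), i) 1) +
    (Pi.single ((v, 2), i) 1 + Pi.single ((v - e L 2, 2), i) 1)

theorem vertexOp_eq_pauli (v : Site L) (i : Fin 2) : vertexOp L v i = pauli (starVec v i) 0 := by
  simp only [vertexOp, X_eq_pauli, pauli_mul, zero_dotProduct, sgn_zero, one_smul, add_zero,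
    starVec]

end Operators

/-! ### Chains on the torus -/

section Chains

variable {L : Fin 3 → ℕ}

/-- The boundary map from `2`-chains to `1`-chains modulo two. -/
def bd : (Plaquette L → ZMod 2) →ₗ[ZMod 2] (Link L → ZMod 2) where
  toFun b l := (b (l.1, l.2 + 2) + b (l.1 - e L (l.2 + 1), l.2 + 2)) +
    (b (l.1, l.2 + 1) + b (l.1 - e L (l.2 + 2), l.2 + 1))
  map_add' b c := by ext l; simp only [Pi.add_apply]; ring
  map_smul' r b := by ext l; simp only [Pi.smul_apply, smul_eq_mul, RingHom.id_apply]; ring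

/-- The coboundary map from `1`-cochains to `2`-cochains modulo two. -/
def cobd (c : Link L → ZMod 2) (P : Plaquette L) : ZMod 2 :=
  (c (P.1, P.2 + 1) + c (P.1 + e L (P.2 + 2), P.2 + 1)) +
    (c (P.1, P.2 + 2) + c (P.1 + e L (P.2 + 1), P.2 + 2))

/-- The linear extension of `overLink`. -/
def toOver : (Plaquette L → ZMod 2) →ₗ[ZMod 2] (Link L → ZMod 2) where
  toFun b l := b (l.1 - e L (l.2 + 1) - e L (l.2 + 2), l.2)
  map_add' _ _ := rfl
  map_smul' _ _ := rfl

/-- The linear extension of `underLink`. -/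
def toUnder : (Plaquette L → ZMod 2) →ₗ[ZMod 2] (Link L → ZMod 2) where
  toFun b l := b (l.1 + e L l.2, l.2)
  map_add' _ _ := rfl
  map_smul' _ _ := rfl

/-- Intersecting with the link over a plaquette is transposed to intersecting with the link under
a plaquette. -/
theorem cobd_toUnder (b : Plaquette L → ZMod 2) (P : Plaquette L) :
    cobd (toUnder b) P = bd b (P.1 + e L (P.2 + 1) + e L (P.2 + 2), P.2) := by
  obtain ⟨v, d⟩ := P
  simp only [cobd, toUnder, bd, LinearMap.coe_mk, AddHom.coe_mk, add_sub_cancel_right]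
  rw [add_right_comm v (e L (d + 2)), add_right_comm v (e L (d + 1)) (e L (d + 2)),
    add_sub_cancel_right, add_right_comm v (e L (d + 2)) (e L (d + 1))]
  ring

theorem toUnder_single (P : Plaquette L) : toUnder (Pi.single P 1) = Pi.single (underLink L P) 1 := by
  ext l
  have h : (l.1 + e L l.2, l.2) = P ↔ l = underLink L P := by
    rw [underLink, Prod.ext_iff, Prod.ext_iff, eq_sub_iff_add_eq]
    constructor <;> rintro ⟨h1, h2⟩ <;> simp_all
  simp only [toUnder, LinearMap.coe_mk, AddHom.coe_mk, Pi.single_apply, h]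

/-- The coboundary of a `0`-cochain. -/
def grad (f : Site L → ZMod 2) (l : Link L) : ZMod 2 := f l.1 + f (l.1 + e L l.2)

/-- The sum of a cochain over the six link ends at a vertex. -/
def vertexSum (a : Link L → ZMod 2) (v : Site L) : ZMod 2 := ∑ d, (a (v, d) + a (v - e L d, d))

/-- This is `∂∂ = 0`; only commutativity of translations is used, so sides of length `1` or `2` are
covered. -/
theorem vertexSum_bd (b : Plaquette L → ZMod 2) (v : Site L) : vertexSum (bd b) v = 0 := by
  have h : ∀ d d', v - e L d - e L d' = v - e L d' - e L d := fun _ _ => sub_right_comm _ _ _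
  simp only [vertexSum, bd, LinearMap.coe_mk, AddHom.coe_mk, Fin.sum_univ_three]
  simp only [Fin.isValue, zero_add, Fin.reduceAdd]
  rw [h 1 0, h 2 0, h 2 1]
  grind

/-- A cocycle and its translate by `(1, 1, 1)` differ by a coboundary. -/
theorem exists_grad_of_cobd_eq_zero {c : Link L → ZMod 2} (hc : ∀ P, cobd c P = 0) :
    ∃ f, grad f = fun l => c l + c (l.1 + e L 0 + e L 1 + e L 2, l.2) := by
  -- The cocycle condition on the square spanned by `d` and `k`, made symmetric in the directions;
  -- it is trivial for `d = k`.
  have h : ∀ (v : Site L) (d k : Fin 3),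
      c (v, d) + c (v + e L k, d) = c (v, k) + c (v + e L d, k) := by
    intro v d k
    have h0 := hc (v, 0)
    have h1 := hc (v, 1)
    have h2 := hc (v, 2)
    simp only [cobd, Fin.isValue, zero_add, Fin.reduceAdd] at h0 h1 h2
    fin_cases d <;> fin_cases k <;>
      simp only [Fin.zero_eta, Fin.mk_one, Fin.reduceFinMk, Fin.isValue] <;> grind
  -- `f` sums `c` along the staircase from `v` to `v + (1, 1, 1)`. Moving the staircase along a link
  -- sweeps out three squares, on each of which `c` sums to zero.
  refine ⟨fun v => c (v, 0) + c (v + e L 0, 1) + c (v + e L 0 + e L 1, 2), ?_⟩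
  ext ⟨v, d⟩
  have h0 := h v d 0
  have h1 := h (v + e L 0) d 1
  have h2 := h (v + e L 0 + e L 1) d 2
  rw [add_right_comm _ _ (e L d)] at h1 h2
  rw [add_right_comm _ _ (e L d)] at h2
  simp only [grad]
  grind

variable [∀ i, NeZero (L i)]

theorem sum_add_shift_mul {G A : Type*} [AddCommGroup G] [Fintype G] [CommSemiring A]
    (w : G) (f g : G → A) : ∑ v, f (v + w) * g v = ∑ v, f v * g (v - w) := by
  rw [← Equiv.sum_comp (Equiv.addRight w) fun v => f v * g (v - w)]
  simp

theorem sum_sub_shift_mul {G A : Type*} [AddCommGroup G] [Fintype G] [CommSemiring A]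
    (w : G) (f g : G → A) : ∑ v, f (v - w) * g v = ∑ v, f v * g (v + w) := by
  simpa [sub_eq_add_neg] using sum_add_shift_mul (-w) f g

theorem bd_dotProduct (b : Plaquette L → ZMod 2) (c : Link L → ZMod 2) :
    bd b ⬝ᵥ c = b ⬝ᵥ cobd c := by
  have h : ∀ (w : Site L) (d d' : Fin 3),
      ∑ v, b (v - w, d) * c (v, d') = ∑ v, b (v, d) * c (v + w, d') :=
    fun w d d' => sum_sub_shift_mul w (fun v => b (v, d)) (fun v => c (v, d'))
  simp only [dotProduct, bd, cobd, LinearMap.coe_mk, AddHom.coe_mk, Fintype.sum_prod_type_right,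
    Fin.sum_univ_three, add_mul, mul_add, Finset.sum_add_distrib]
  simp only [h]
  simp only [Fin.isValue, zero_add, Fin.reduceAdd]
  ring

theorem toOver_dotProduct (b : Plaquette L → ZMod 2) (c : Link L → ZMod 2) :
    toOver b ⬝ᵥ c = b ⬝ᵥ fun P => c (P.1 + e L (P.2 + 1) + e L (P.2 + 2), P.2) := by
  simp only [dotProduct, toOver, LinearMap.coe_mk, AddHom.coe_mk, Fintype.sum_prod_type_right]
  refine Finset.sum_congr rfl fun d _ => ?_
  simp only [sub_sub, add_assoc]
  exact sum_sub_shift_mul _ (fun v => b (v, d)) (fun v => c (v, d))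

/-- Symmetry of the linking pairing: pushing one surface up or the other one down gives the same
intersections. `quad_add` rests on it. -/
theorem toOver_dotProduct_bd (b c : Plaquette L → ZMod 2) :
    toOver b ⬝ᵥ bd c = bd b ⬝ᵥ toUnder c := by
  rw [toOver_dotProduct, bd_dotProduct]
  simp only [← cobd_toUnder]

theorem toOver_single (P : Plaquette L) : toOver (Pi.single P 1) = Pi.single (overLink L P) 1 := by
  refine dotProduct_eq _ _ fun c => ?_
  rw [toOver_dotProduct, single_dotProduct, single_dotProduct]
  rfl

theorem bd_single (P : Plaquette L) : bd (Pi.single P 1) =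
    (Pi.single (P.1, P.2 + 1) 1 + Pi.single (P.1 + e L (P.2 + 2), P.2 + 1) 1) +
      (Pi.single (P.1, P.2 + 2) 1 + Pi.single (P.1 + e L (P.2 + 1), P.2 + 2) 1) := by
  refine dotProduct_eq _ _ fun c => ?_
  simp only [bd_dotProduct, add_dotProduct, single_dotProduct, one_mul, cobd]

/-- The link over a plaquette runs along its normal and the boundary links do not, so they stay
distinct even on the smallest tori. -/
theorem toOver_single_dotProduct_bd (P : Plaquette L) :
    toOver (Pi.single P 1) ⬝ᵥ bd (Pi.single P 1) = 0 := by
  have h : ∀ d : Fin 3, d + 2 ≠ d ∧ d + 1 ≠ d := by decide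
  rw [toOver_single, single_dotProduct]
  simp [bd, overLink, Prod.ext_iff, h]

theorem dotProduct_grad (a : Link L → ZMod 2) (f : Site L → ZMod 2) :
    a ⬝ᵥ grad f = vertexSum a ⬝ᵥ f := by
  simp only [dotProduct, grad, vertexSum, Fintype.sum_prod_type_right, Finset.sum_mul]
  conv_rhs => rw [Finset.sum_comm]
  refine Finset.sum_congr rfl fun d _ => ?_
  simp only [mul_add, add_mul, Finset.sum_add_distrib]
  rw [sum_sub_shift_mul _ (fun v => a (v, d)) f]

end Chains

/-! ### Pairs of chains -/

section Pairs

variable {L : Fin 3 → ℕ}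

/-- The part of a pair of chains on the qubits of type `i`. -/
def layer (i : Fin 2) : (Qubit L → ZMod 2) →ₗ[ZMod 2] (Link L → ZMod 2) :=
  LinearMap.funLeft (ZMod 2) (ZMod 2) fun l => (l, i)

/-- The `Z`-part of a product of plaquette operators. -/
def pairBd : (Qubit L → ZMod 2) →ₗ[ZMod 2] (Qubit L → ZMod 2) :=
  LinearMap.pi fun q => LinearMap.proj q.1 ∘ₗ bd ∘ₗ layer q.2

/-- The `X`-part of a product of plaquette operators. -/
def pairX : (Qubit L → ZMod 2) →ₗ[ZMod 2] (Qubit L → ZMod 2) :=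
  LinearMap.pi fun q => LinearMap.proj q.1 ∘ₗ
    if q.2 = 0 then toOver ∘ₗ layer 0 + toUnder ∘ₗ layer 0 + toOver ∘ₗ layer 1
    else toUnder ∘ₗ layer 0 + toOver ∘ₗ layer 1 + toUnder ∘ₗ layer 1

theorem layer_pairBd (i : Fin 2) (b : Qubit L → ZMod 2) :
    layer i (pairBd b) = bd (layer i b) := rfl

theorem layer_zero_pairX (b : Qubit L → ZMod 2) :
    layer 0 (pairX b) = toOver (layer 0 b) + toUnder (layer 0 b) + toOver (layer 1 b) := rfl

theorem layer_one_pairX (b : Qubit L → ZMod 2) :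
    layer 1 (pairX b) = toUnder (layer 0 b) + toOver (layer 1 b) + toUnder (layer 1 b) := rfl

theorem layer_ext {a b : Qubit L → ZMod 2} (h0 : layer 0 a = layer 0 b)
    (h1 : layer 1 a = layer 1 b) : a = b := by
  ext ⟨l, i⟩
  fin_cases i
  · exact congrFun h0 l
  · exact congrFun h1 l

theorem layer_single_same (i : Fin 2) (l : Link L) :
    layer i (Pi.single (l, i) (1 : ZMod 2)) = Pi.single l 1 := by
  ext k
  simp [layer, LinearMap.funLeft_apply, Pi.single_apply]

theorem layer_single_of_ne {i j : Fin 2} (h : i ≠ j) (l : Link L) :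
    layer i (Pi.single (l, j) (1 : ZMod 2)) = 0 := by
  ext k
  simp [layer, LinearMap.funLeft_apply, h]

theorem cobd_translate (c : Link L → ZMod 2) (w : Site L) (P : Plaquette L) :
    cobd (fun l => c (l.1 + w, l.2)) P = cobd c (P.1 + w, P.2) := by
  simp only [cobd, add_right_comm _ _ w]

theorem bd_eq_zero_of_cobd_toUnder_eq_zero {b : Plaquette L → ZMod 2}
    (h : ∀ P, cobd (toUnder b) P = 0) : bd b = 0 := by
  ext ⟨v, d⟩
  have := h (v - e L (d + 2) - e L (d + 1), d)
  rwa [cobd_toUnder, sub_add_cancel, sub_add_cancel] at this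

theorem add_e_add_e_add_e (v : Site L) (d : Fin 3) :
    v + e L (d + 1) + e L (d + 2) + e L d = v + e L 0 + e L 1 + e L 2 := by
  fin_cases d <;> simp only [Fin.zero_eta, Fin.mk_one, Fin.reduceFinMk, Fin.isValue, zero_add,
    Fin.reduceAdd] <;> abel

/-- Every cocycle is carried by the links under a closed surface. -/
theorem exists_closed_toUnder_eq {c : Link L → ZMod 2} (hc : ∀ P, cobd c P = 0) :
    ∃ b, toUnder b = c ∧ (∃ f, grad f = c + toOver b) ∧ bd b = 0 := by
  let b : Plaquette L → ZMod 2 := fun P => c (P.1 - e L P.2, P.2)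
  have hu : toUnder b = c := by
    ext ⟨v, d⟩
    simp [toUnder, b]
  have hw : ∀ v : Site L, v + e L 0 + e L 1 + e L 2 = v + (e L 0 + e L 1 + e L 2) := by
    intro v; abel
  obtain ⟨f, hf⟩ := exists_grad_of_cobd_eq_zero
    (c := fun l => c (l.1 + -(e L 0 + e L 1 + e L 2), l.2))
    -- The links over `b` carry `c` translated by `-(1, 1, 1)`, so the staircase lemma is applied to
    -- that translate.
    (fun P => (cobd_translate c _ P).trans (hc _))
  refine ⟨b, hu, ⟨f, ?_⟩, bd_eq_zero_of_cobd_toUnder_eq_zero (by rwa [hu])⟩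
  rw [hf]
  ext ⟨v, d⟩
  have h1 : v - e L (d + 1) - e L (d + 2) - e L d = v + -(e L 0 + e L 1 + e L 2) := by
    rw [← add_left_inj (e L 0 + e L 1 + e L 2), neg_add_cancel_right, ← hw, ← add_e_add_e_add_e _ d]
    abel
  simp only [toOver, b, LinearMap.coe_mk, AddHom.coe_mk, Pi.add_apply, h1, hw, add_neg_cancel_right]
  ring

/-- Every cocycle is carried by the links over a closed surface. -/
theorem exists_closed_toOver_eq {c : Link L → ZMod 2} (hc : ∀ P, cobd c P = 0) :
    ∃ b, toOver b = c ∧ (∃ f, grad f = c + toUnder b) ∧ bd b = 0 := by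
  let b : Plaquette L → ZMod 2 := fun P => c (P.1 + e L (P.2 + 1) + e L (P.2 + 2), P.2)
  have hw : ∀ v : Site L, v + e L 0 + e L 1 + e L 2 = v + (e L 0 + e L 1 + e L 2) := by
    intro v; abel
  have hu : toUnder b = fun l => c (l.1 + (e L 0 + e L 1 + e L 2), l.2) := by
    ext ⟨v, d⟩
    simp only [toUnder, b, LinearMap.coe_mk, AddHom.coe_mk, ← hw, ← add_e_add_e_add_e v d]
    rw [add_right_comm v (e L d), add_right_comm (v + _) (e L d)]
  obtain ⟨f, hf⟩ := exists_grad_of_cobd_eq_zero hc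
  refine ⟨b, ?_, ⟨f, ?_⟩, bd_eq_zero_of_cobd_toUnder_eq_zero fun P => ?_⟩
  · ext ⟨v, d⟩
    simp only [toOver, b, LinearMap.coe_mk, AddHom.coe_mk]
    rw [sub_right_comm, sub_add_cancel, sub_add_cancel]
  · rw [hf, hu]
    simp only [hw]
    rfl
  · rw [hu, cobd_translate, hc]

variable [∀ i, NeZero (L i)]

theorem dotProduct_eq_add_layer (a b : Qubit L → ZMod 2) :
    a ⬝ᵥ b = layer 0 a ⬝ᵥ layer 0 b + layer 1 a ⬝ᵥ layer 1 b := by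
  simp only [dotProduct, Fintype.sum_prod_type_right (γ := ZMod 2), Fin.sum_univ_two]
  rfl

theorem dotProduct_starVec (a : Qubit L → ZMod 2) (v : Site L) (i : Fin 2) :
    a ⬝ᵥ starVec v i = vertexSum (layer i a) v := by
  simp only [starVec, dotProduct_add, dotProduct_single, mul_one, vertexSum, Fin.sum_univ_three]
  rfl

theorem pairBd_dotProduct_starVec (b : Qubit L → ZMod 2) (v : Site L) (i : Fin 2) :
    pairBd b ⬝ᵥ starVec v i = 0 := by
  rw [dotProduct_starVec, layer_pairBd, vertexSum_bd]

/-- The quadratic form (a self-linking number) giving the signs of products of plaquette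
operators. -/
def quad (b : Qubit L → ZMod 2) : ZMod 2 :=
  toOver (layer 0 b) ⬝ᵥ bd (layer 0 b) + toOver (layer 1 b) ⬝ᵥ bd (layer 1 b) +
    toOver (layer 1 b) ⬝ᵥ bd (layer 0 b)

theorem quad_zero : quad (0 : Qubit L → ZMod 2) = 0 := by
  simp [quad]

theorem quad_add (b c : Qubit L → ZMod 2) :
    quad (b + c) = quad b + quad c + pairBd b ⬝ᵥ pairX c := by
  simp only [quad, dotProduct_eq_add_layer, layer_pairBd, layer_zero_pairX, layer_one_pairX,
    map_add, dotProduct_add, add_dotProduct, ← toOver_dotProduct_bd,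
    dotProduct_comm (bd _) (toOver _)]
  ring

/-- A product of plaquette operators over a closed surface thus carries no sign, which excludes
cancellation in the ground state. -/
theorem quad_eq_zero_of_closed {b : Qubit L → ZMod 2} (h : pairBd b = 0) : quad b = 0 := by
  have h' : ∀ i, bd (layer i b) = 0 := fun i => by rw [← layer_pairBd, h, map_zero]
  simp only [quad, h', dotProduct_zero, add_zero]

theorem quad_single (p : Qubit L) : quad (Pi.single p 1) = 0 := by
  obtain ⟨P, i⟩ := p
  fin_cases i <;>
    simp [quad, layer_single_same, layer_single_of_ne, toOver_single_dotProduct_bd]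

theorem pairBd_dotProduct_pairX_self (b : Qubit L → ZMod 2) : pairBd b ⬝ᵥ pairX b = 0 := by
  have h := quad_add b b
  rwa [add_self_eq_zero_of_bits, quad_zero, CharTwo.add_self_eq_zero, zero_add, eq_comm] at h

theorem plaquetteOp_eq_pauli (P : Plaquette L) (i : Fin 2) :
    plaquetteOp L P i = pauli (pairX (Pi.single (P, i) 1)) (pairBd (Pi.single (P, i) 1)) := by
  have h0 : ∀ j, pairBd (Pi.single (P, j) 1) =
      (Pi.single ((P.1, P.2 + 1), j) 1 + Pi.single ((P.1 + e L (P.2 + 2), P.2 + 1), j) 1) +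
      (Pi.single ((P.1, P.2 + 2), j) 1 + Pi.single ((P.1 + e L (P.2 + 1), P.2 + 2), j) 1) := by
    intro j
    fin_cases j <;> apply layer_ext <;>
      simp [layer_pairBd, layer_single_same, layer_single_of_ne, bd_single]
  have h1 : pairX (Pi.single (P, 0) 1) = Pi.single (overLink L P, 0) 1 +
      Pi.single (underLink L P, 0) 1 + Pi.single (underLink L P, 1) 1 := by
    apply layer_ext <;>
      simp [layer_zero_pairX, layer_one_pairX, layer_single_same, layer_single_of_ne,
        toOver_single, toUnder_single]
  have h2 : pairX (Pi.single (P, 1) 1) = Pi.single (overLink L P, 0) 1 +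
      Pi.single (overLink L P, 1) 1 + Pi.single (underLink L P, 1) 1 := by
    apply layer_ext <;>
      simp [layer_zero_pairX, layer_one_pairX, layer_single_same, layer_single_of_ne,
        toOver_single, toUnder_single]
  have h3 : ∀ j, boundaryZ L P j = pauli 0 (pairBd (Pi.single (P, j) 1)) := by
    intro j
    simp only [boundaryZ, Z_eq_pauli, pauli_mul, dotProduct_zero, sgn_zero, one_smul, add_zero, h0]
  -- Moving the `X`-factors past the `Z`-factors costs the sign of this pairing, which is trivial.
  have h4 := fun j => pairBd_dotProduct_pairX_self (Pi.single (P, j) 1)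
  fin_cases i
  · have h5 := h4 0
    rw [h1] at h5
    simp [plaquetteOp, X_eq_pauli, h3, pauli_mul, h1, h5]
  · have h5 := h4 1
    rw [h2] at h5
    simp [plaquetteOp, X_eq_pauli, h3, pauli_mul, h2, h5]

/-- A pair of `1`-chains which commutes with the vertex operators and with all products of plaquette
operators over closed surfaces is a boundary. -/
theorem exists_pairBd_eq {a : Qubit L → ZMod 2} (h1 : ∀ v i, a ⬝ᵥ starVec v i = 0)
    (h2 : ∀ b, pairBd b = 0 → a ⬝ᵥ pairX b = 0) : ∃ b, pairBd b = a := by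
  by_contra hne
  -- If `a` is not a boundary, a functional `c` vanishing on boundaries, that is, a pair of
  -- cocycles, detects it.
  obtain ⟨f, hfa, hf⟩ := Submodule.exists_le_ker_of_notMem (p := LinearMap.range pairBd) (v := a)
    (by simpa using hne)
  obtain ⟨c, rfl⟩ := (dotProductEquiv (ZMod 2) (Qubit L)).surjective f
  have hc : ∀ i P, cobd (layer i c) P = 0 := by
    intro i P
    have h : c ⬝ᵥ pairBd (Pi.single (P, i) 1) = 0 := hf ⟨Pi.single (P, i) 1, rfl⟩
    rw [dotProduct_comm, dotProduct_eq_add_layer, layer_pairBd, layer_pairBd, bd_dotProduct,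
      bd_dotProduct] at h
    fin_cases i <;> simpa [layer_single_same, layer_single_of_ne] using h
  have hgrad : ∀ i g, layer i a ⬝ᵥ grad g = 0 := by
    intro i g
    rw [dotProduct_grad, funext fun v => (dotProduct_starVec a v i).symm.trans (h1 v i)]
    exact zero_dotProduct _
  obtain ⟨b₀, hu0, ⟨g₀, hg0⟩, hb0⟩ := exists_closed_toUnder_eq (hc 1)
  obtain ⟨b₁, ho1, ⟨g₁, hg1⟩, hb1⟩ := exists_closed_toOver_eq (hc 0)
  -- The layers are crossed: `b₀` comes from layer `1` of `c` and `b₁` from layer `0`. In `pairX b`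
  -- the over- and under-links of the same surface sum to a gradient, leaving `c` plus gradients.
  -- Since `a` is orthogonal to gradients, `a ⬝ᵥ c = 0`, a contradiction.
  let b : Qubit L → ZMod 2 := fun q => if q.2 = 0 then b₀ q.1 else b₁ q.1
  have hl0 : layer 0 b = b₀ := rfl
  have hl1 : layer 1 b = b₁ := rfl
  have h3 := h2 b (layer_ext (by rw [layer_pairBd, hl0, hb0, map_zero])
    (by rw [layer_pairBd, hl1, hb1, map_zero]))
  rw [dotProduct_eq_add_layer, layer_zero_pairX, layer_one_pairX, hl0, hl1,
    add_comm (toOver b₀), hu0, ← hg0, add_assoc (layer 1 c), ho1, ← hg1, dotProduct_add,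
    dotProduct_add, hgrad, hgrad, zero_add, add_zero, ← dotProduct_eq_add_layer,
    dotProduct_comm] at h3
  exact hfa h3

end Pairs

/-! ### The ground state -/

section GroundState

variable (L : Fin 3 → ℕ) [∀ i, NeZero (L i)]

/-- The ground state: a signed superposition of the characters given by boundaries. -/
def groundState (s : Config L) : ℂ :=
  ∑ b : Qubit L → ZMod 2, sgn (quad b + pairBd b ⬝ᵥ bits s)

theorem vertexOp_mulVec_groundState (v : Site L) (i : Fin 2) :
    vertexOp L v i *ᵥ groundState L = groundState L := by
  ext s
  rw [vertexOp_eq_pauli, pauli_mulVec, zero_dotProduct, sgn_zero, one_mul]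
  simp only [groundState, Equiv.apply_symm_apply, dotProduct_add, pairBd_dotProduct_starVec,
    add_zero]

theorem plaquetteOp_mulVec_groundState (P : Plaquette L) (i : Fin 2) :
    plaquetteOp L P i *ᵥ groundState L = groundState L := by
  ext s
  rw [plaquetteOp_eq_pauli, pauli_mulVec]
  simp only [groundState, Equiv.apply_symm_apply, Finset.mul_sum, ← sgn_add]
  -- Adding the plaquette to the summation index produces exactly the phase of the operator, by
  -- `quad_add` and `quad_single`.
  rw [← Equiv.sum_comp (Equiv.addRight (Pi.single (P, i) 1)) fun b : Qubit L → ZMod 2 =>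
    sgn (quad b + pairBd b ⬝ᵥ bits s)]
  refine Finset.sum_congr rfl fun b _ => congrArg sgn ?_
  rw [Equiv.coe_addRight, quad_add, quad_single, map_add, add_dotProduct, dotProduct_add]
  ring

variable {L}

/-- Summing over `s` keeps only closed `b`, and each of these contributes the same positive number.
-/
theorem sum_groundState_ne_zero : ∑ s, groundState L s ≠ 0 := by
  have h : ∑ s, groundState L s = ∑ b : Qubit L → ZMod 2,
      if pairBd b = 0 then (Fintype.card (Qubit L → ZMod 2) : ℂ) else 0 := by
    simp only [groundState, sgn_add]
    rw [Finset.sum_comm]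
    refine Finset.sum_congr rfl fun b _ => ?_
    rw [← Finset.mul_sum, Equiv.sum_comp bits fun s => sgn (pairBd b ⬝ᵥ s), sum_sgn_dotProduct]
    split_ifs with hb
    · rw [quad_eq_zero_of_closed hb, sgn_zero, one_mul]
    · rw [mul_zero]
  rw [h, ← Finset.sum_filter, Finset.sum_const, nsmul_eq_mul]
  have h0 : (0 : Qubit L → ZMod 2) ∈
      Finset.univ.filter fun b : Qubit L → ZMod 2 => pairBd b = 0 := by simp
  exact mul_ne_zero (Nat.cast_ne_zero.mpr (Finset.card_ne_zero_of_mem h0))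
    (Nat.cast_ne_zero.mpr Fintype.card_ne_zero)

theorem groundState_ne_zero : groundState L ≠ 0 := by
  intro h
  exact sum_groundState_ne_zero (L := L) (by simp [h])

/-- Relations for single plaquettes compose: the cross term from shifting `a` by `pairBd b` is the
polarization term in `quad_add`. -/
theorem fourier_of_plaquettes {φ : (Qubit L → ZMod 2) → ℂ}
    (hP : ∀ (p : Qubit L) (a : Qubit L → ZMod 2), fourier φ a =
      sgn (a ⬝ᵥ pairX (Pi.single p 1)) * fourier φ (a + pairBd (Pi.single p 1)))
    (b : Qubit L → ZMod 2) : ∀ a, fourier φ a =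
      sgn (a ⬝ᵥ pairX b + quad b) * fourier φ (a + pairBd b) := by
  rw [← Finset.univ_sum_single b]
  refine Finset.sum_induction _ (fun b => ∀ a, fourier φ a =
    sgn (a ⬝ᵥ pairX b + quad b) * fourier φ (a + pairBd b)) ?_ ?_ ?_
  · intro b c hb hc a
    rw [hb a, hc, ← mul_assoc, ← sgn_add, quad_add, map_add, map_add, add_dotProduct,
      dotProduct_add, ← add_assoc a]
    congr 2
    ring
  · intro a
    simp [quad_zero]
  · intro p _ a
    have h : ∀ k : ZMod 2, k = 0 ∨ k = 1 := by decide
    rcases h (b p) with hp | hp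
    · simp [hp, quad_zero]
    · rw [hp, quad_single, add_zero, ← hP]

/-- A vector fixed by all vertex and plaquette operators is determined by the sum of its
entries. -/
theorem eq_zero_of_stabilized {φ : Config L → ℂ} (hA : ∀ v i, vertexOp L v i *ᵥ φ = φ)
    (hB : ∀ P i, plaquetteOp L P i *ᵥ φ = φ) (h0 : ∑ s, φ s = 0) : φ = 0 := by
  set χ : (Qubit L → ZMod 2) → ℂ := φ ∘ bits.symm with hχ
  have hstab : ∀ u a : Qubit L → ZMod 2, a ⬝ᵥ u = 0 → pauli u a *ᵥ φ = φ →
      ∀ c, fourier χ c = sgn (c ⬝ᵥ u) * fourier χ (c + a) := by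
    intro u a h hφ
    refine fourier_of_stabilized h fun s => ?_
    have h1 := congrFun hφ (bits.symm s)
    rwa [pauli_mulVec, Equiv.apply_symm_apply] at h1
  have hfB := fourier_of_plaquettes (φ := χ) fun p => hstab _ _ (pairBd_dotProduct_pairX_self _)
    (by rw [← plaquetteOp_eq_pauli]; exact hB _ _)
  have hzero : fourier χ 0 = 0 := by
    simp only [fourier, zero_dotProduct, sgn_zero, one_mul, hχ, Function.comp_apply]
    rw [Equiv.sum_comp bits.symm φ, h0]
  have hχ0 : χ = 0 := by
    refine eq_zero_of_fourier_eq_zero fun a => ?_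
    by_contra ha
    have hsgn : ∀ k, fourier χ a = sgn k * fourier χ a → k = 0 := by
      intro k hk
      refine (sgn_eq_one_or_neg_one k).resolve_right fun h => ha ?_
      rw [h, neg_one_mul] at hk
      exact self_eq_neg.mp hk
    -- Vertex operators and closed `b` relate the coefficient at `a` to itself up to a sign, which
    -- must be trivial where it is nonzero.
    obtain ⟨b, rfl⟩ := exists_pairBd_eq (a := a)
      (fun v i => hsgn _ (by
        simpa using hstab (starVec v i) 0 (zero_dotProduct _)
          (by rw [← vertexOp_eq_pauli]; exact hA v i) a))
      (fun b hb => hsgn _ (by simpa [hb, quad_eq_zero_of_closed hb] using hfB b a))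
    -- The coefficient at a boundary is, up to sign, the coefficient at `0`, the vanishing sum of
    -- the entries.
    have h1 := hfB b 0
    rw [hzero, zero_dotProduct, zero_add, zero_add, eq_comm, mul_eq_zero] at h1
    rcases h1 with h1 | h1
    · have h2 := sgn_mul_self (quad b)
      rw [h1, zero_mul] at h2
      exact zero_ne_one h2
    · exact ha h1
  ext s
  simpa [hχ] using congrFun hχ0 (bits s)

theorem exists_smul_groundState {φ : Config L → ℂ} (hA : ∀ v i, vertexOp L v i *ᵥ φ = φ)
    (hB : ∀ P i, plaquetteOp L P i *ᵥ φ = φ) : ∃ c : ℂ, φ = c • groundState L := by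
  refine ⟨(∑ s, φ s) / ∑ s, groundState L s, sub_eq_zero.mp (eq_zero_of_stabilized ?_ ?_ ?_)⟩
  · intro v i
    rw [mulVec_sub, mulVec_smul, hA, vertexOp_mulVec_groundState]
  · intro P i
    rw [mulVec_sub, mulVec_smul, hB, plaquetteOp_mulVec_groundState]
  · simp only [Pi.sub_apply, Pi.smul_apply, smul_eq_mul, Finset.sum_sub_distrib,
      ← Finset.mul_sum]
    rw [div_mul_cancel₀ _ sum_groundState_ne_zero, sub_self]

theorem neg_term_isHermitian (t : (Site L × Fin 2) ⊕ (Plaquette L × Fin 2)) :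
    (-term L t).IsHermitian := by
  rcases t with ⟨v, i⟩ | ⟨P, i⟩
  · rw [term, neg_neg, vertexOp_eq_pauli]
    exact pauli_isHermitian (zero_dotProduct _)
  · rw [term, neg_neg, plaquetteOp_eq_pauli]
    exact pauli_isHermitian (pairBd_dotProduct_pairX_self _)

theorem neg_term_mul_self (t : (Site L × Fin 2) ⊕ (Plaquette L × Fin 2)) :
    -term L t * -term L t = 1 := by
  rcases t with ⟨v, i⟩ | ⟨P, i⟩
  · rw [term, neg_neg, vertexOp_eq_pauli]
    exact pauli_mul_self (zero_dotProduct _)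
  · rw [term, neg_neg, plaquetteOp_eq_pauli]
    exact pauli_mul_self (pairBd_dotProduct_pairX_self _)

theorem neg_term_mulVec_groundState (t : (Site L × Fin 2) ⊕ (Plaquette L × Fin 2)) :
    -term L t *ᵥ groundState L = groundState L := by
  rcases t with ⟨v, i⟩ | ⟨P, i⟩
  · rw [term, neg_neg, vertexOp_mulVec_groundState]
  · rw [term, neg_neg, plaquetteOp_mulVec_groundState]

theorem hamiltonian_eq_sum_term : hamiltonian L = ∑ t, term L t := by
  simp only [hamiltonian, term, Fintype.sum_sum_type, Finset.sum_neg_distrib,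
    Fintype.sum_prod_type (γ := Op L), Fin.sum_univ_two, sub_eq_add_neg]

theorem hamiltonian_eq_sum_neg_neg_term : hamiltonian L = ∑ t, -(-term L t) := by
  simp only [neg_neg, hamiltonian_eq_sum_term]

theorem isGroundState_groundState : IsGroundState (hamiltonian L) (groundState L) := by
  rw [hamiltonian_eq_sum_neg_neg_term]
  exact isGroundState_of_stabilized neg_term_isHermitian neg_term_mul_self groundState_ne_zero
    neg_term_mulVec_groundState

theorem isGroundState_term (t : (Site L × Fin 2) ⊕ (Plaquette L × Fin 2)) :
    IsGroundState (term L t) (groundState L) := by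
  -- A single term is treated as a Hamiltonian with one summand.
  have h := isGroundState_of_stabilized (ι := Unit) (fun _ => neg_term_isHermitian t)
    (fun _ => neg_term_mul_self t) groundState_ne_zero fun _ => neg_term_mulVec_groundState t
  simpa using h

theorem hamiltonian_isHermitian : (hamiltonian L).IsHermitian := by
  rw [hamiltonian_eq_sum_term, IsHermitian, conjTranspose_sum]
  refine Finset.sum_congr rfl fun t _ => ?_
  rw [← neg_inj, ← conjTranspose_neg]
  exact neg_term_isHermitian t

end GroundState

end

end WalkerWang

theorem mainTheorem9 :
    (∀ (L : Fin 3 → ℕ) [∀ i, NeZero (L i)],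
      (WalkerWang.hamiltonian L).IsHermitian ∧
      WalkerWang.FrustrationFree (WalkerWang.hamiltonian L) (WalkerWang.term L) ∧
      ∃ ψ : WalkerWang.Config L → ℂ,
        WalkerWang.IsGroundState (WalkerWang.hamiltonian L) ψ ∧
        (∀ φ : WalkerWang.Config L → ℂ,
          WalkerWang.IsGroundState (WalkerWang.hamiltonian L) φ → ∃ c : ℂ, φ = c • ψ) ∧
        (∀ (v : WalkerWang.Site L) (i : Fin 2), (WalkerWang.vertexOp L v i).mulVec ψ = ψ) ∧
        (∀ (P : WalkerWang.Plaquette L) (i : Fin 2),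
          (WalkerWang.plaquetteOp L P i).mulVec ψ = ψ)) ∧
    WalkerWang.determinantalIdeal 6 WalkerWang.stabilizerMap = ⊤ := by
  refine ⟨fun L _ => ⟨WalkerWang.hamiltonian_isHermitian,
    ⟨WalkerWang.hamiltonian_eq_sum_term, WalkerWang.groundState L,
      WalkerWang.isGroundState_groundState, WalkerWang.isGroundState_term⟩,
    WalkerWang.groundState L, WalkerWang.isGroundState_groundState, fun φ hφ => ?_,
    WalkerWang.vertexOp_mulVec_groundState L, WalkerWang.plaquetteOp_mulVec_groundState L⟩,
    WalkerWang.determinantalIdeal_stabilizerMap⟩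
  rw [WalkerWang.hamiltonian_eq_sum_neg_neg_term] at hφ
  have h := WalkerWang.stabilized_of_isGroundState WalkerWang.neg_term_isHermitian
    WalkerWang.neg_term_mul_self WalkerWang.groundState_ne_zero
    WalkerWang.neg_term_mulVec_groundState hφ
  refine WalkerWang.exists_smul_groundState (fun v i => ?_) fun P i => ?_
  · simpa only [WalkerWang.term, neg_neg] using h (.inl (v, i))
  · simpa only [WalkerWang.term, neg_neg] using h (.inr (P, i))
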